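/- Let $n\ge 0$, $m\ge 1$, $K\ge 1$ be integers, write $[r]=\{1,\dots,r\}$, and let $S_k:\mathcal X\to\mathbb R$, $k\in[K]$, be fixed (pre-trained) measurable score functions. Let $(X_i,Y_i)_{i\in[n+m]}$ be random pairs with values in $\mathcal X\times[K]$; the calibration sample $(X_j,Y_j)_{j\in[n]}$ and the batch covariates $(X_{n+i})_{i\in[m]}$ are observed, the batch labels $(Y_{n+i})_{i\in[m]}$ are not. Assume that the scores $S_{Y_i}(X_i)$, $i\in[n+m]$, almost surely have no ties. For $k\in[K]$ and $i\in[m]$ define the conformal $p$-value $$p_i^{(k)}=\frac{1}{|\mathcal D^{(k)}|+1}\Big(1+\sum_{j\in\mathcal D^{(k)}}\mathbf 1\{S_{Y_j}(X_j)\ge S_k(X_{n+i})\}\Big),$$ called full-calibrated if $\mathcal D^{(k)}=[n]$ and class-calibrated if $\mathcal D^{(k)}=\{j\in[n]:Y_j=k\}$. For $y=(y_{n+i})_{i\in[m]}\in[K]^m$ let $p_{(1)}(y)\le\dots\le p_{(m)}(y)$ be the values $p_i^{(y_{n+i})}$, $i\in[m]$, in increasing order. For $\alpha\ge 0$ the Simes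 batch prediction set is $$\mathcal C^m_\alpha=\Big\{y\in[K]^m:\ \min_{\ell\in[m]}\frac{m\,p_{(\ell)}(y)}{\ell}>\alpha\Big\}.$$ 1. (iid model.) If the pairs $(X_i,Y_i)$, $i\in[n+m]$, are independent and identically distributed, then with full-calibrated $p$-values $$\mathbb P\big((Y_{n+i})_{i\in[m]}\in\mathcal C^m_\alpha\big)\ge 1-\alpha.$$ 2. (Class-conditional model.) Suppose that the label vector $(Y_j)_{j\in[n+m]}$ has an arbitrary (possibly degenerate) distribution and that, conditionally on it, the covariates $X_1,\dots,X_{n+m}$ are independent, $X_i$ having a distribution $Q_{Y_i}$ that depends only on its own label, for some distributions $(Q_k)_{k\in[K]}$ on $\mathcal X$. Then with class-calibrated $p$-values $$\mathbb P\big((Y_{n+i})_{i\in[m]}\in\mathcal C^m_\alpha\,\big|\,(Y_j)_{j\in[n+m]}\big)\ge 1-\alpha\quad\text{almost surely},$$ that is, the bound holds conditionally on $(Y_j)_{j\in[n+m]}=y$ for every $y\in[K]^{n+m}$ of positive probability (in particular, for every deterministic label vector). -/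

import Mathlib

open MeasureTheory ProbabilityTheory

noncomputable section

namespace BatchConformal

/-- The conformal p-value `p_i^{(k)}` of the null "the `i`-th batch label is `k`", computed from the
scores `S`, the calibration sample `(x_j, y_j)`, `j ∈ [n]`, and the batch covariates `x'_i`, with
calibration indices `D k` for the label `k`. -/
def pValue {𝒳 : Type*} {n m K : ℕ} (S : Fin K → 𝒳 → ℝ) (D : Fin K → Finset (Fin n))
    (x : Fin n → 𝒳) (y : Fin n → Fin K) (x' : Fin m → 𝒳) (k : Fin K) (i : Fin m) : ℝ :=
  (1 + ∑ j ∈ D k, if S k (x' i) ≤ S (y j) (x j) then (1 : ℝ) else 0) / ((D k).card + 1)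

/-- Calibration indices of the full-calibrated p-values: all of `[n]`. -/
def fullCal (n K : ℕ) : Fin K → Finset (Fin n) := fun _ => Finset.univ

/-- Calibration indices of the class-calibrated p-values: those `j ∈ [n]` with label `k`. -/
def classCal {n K : ℕ} (y : Fin n → Fin K) : Fin K → Finset (Fin n) :=
  fun k => Finset.univ.filter fun j => y j = k

/-- The order statistics of `p` in increasing order; `Fin m` is zero-based, so `orderStat p ℓ` is
the `(ℓ + 1)`-st smallest entry. -/
def orderStat {m : ℕ} (p : Fin m → ℝ) (ℓ : Fin m) : ℝ := p (Tuple.sort p ℓ)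

/-- The Simes combination `min_{ℓ ∈ [m]} m p_(ℓ) / ℓ` (meaningful for `m ≥ 1`). -/
def simes {m : ℕ} (p : Fin m → ℝ) : ℝ :=
  ⨅ ℓ : Fin m, (m : ℝ) * orderStat p ℓ / ((ℓ : ℕ) + 1)

/-- The Simes batch prediction set attached to a family of p-values `p_i^{(k)}`. -/
def simesSet {m K : ℕ} (p : Fin K → Fin m → ℝ) (α : ℝ) : Set (Fin m → Fin K) :=
  {y | α < simes fun i => p (y i) i}

/-- The Simes batch prediction set with full-calibrated p-values. -/
def fullSimesSet {𝒳 : Type*} {n m K : ℕ} (S : Fin K → 𝒳 → ℝ) (x : Fin n → 𝒳)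
    (y : Fin n → Fin K) (x' : Fin m → 𝒳) (α : ℝ) : Set (Fin m → Fin K) :=
  simesSet (pValue S (fullCal n K) x y x') α

/-- The Simes batch prediction set with class-calibrated p-values. -/
def classSimesSet {𝒳 : Type*} {n m K : ℕ} (S : Fin K → 𝒳 → ℝ) (x : Fin n → 𝒳)
    (y : Fin n → Fin K) (x' : Fin m → 𝒳) (α : ℝ) : Set (Fin m → Fin K) :=
  simesSet (pValue S (classCal y) x y x') α

/-- The event that the whole label vector equals `y`. -/
def labelEvent {Ω : Type*} {N K : ℕ} (Y : Fin N → Ω → Fin K) (y : Fin N → Fin K) : Set Ω :=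
  {ω | ∀ i, Y i ω = y i}

/-- The iid model: the pairs `(X_i, Y_i)` are independent and identically distributed. -/
def IIDModel {Ω 𝒳 : Type*} [MeasurableSpace Ω] [MeasurableSpace 𝒳] {N K : ℕ} (P : Measure Ω)
    (X : Fin N → Ω → 𝒳) (Y : Fin N → Ω → Fin K) : Prop :=
  iIndepFun (fun i ω => (X i ω, Y i ω)) P ∧
    ∀ i j, IdentDistrib (fun ω => (X i ω, Y i ω)) (fun ω => (X j ω, Y j ω)) P P

/-- The class-conditional model: the label vector has an arbitrary law (possibly a Dirac mass), and
conditionally on it the covariates are independent, the `i`-th one having a law `Q (Y_i)` that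
depends only on its own label. -/
def ClassConditionalModel {Ω 𝒳 : Type*} [MeasurableSpace Ω] [MeasurableSpace 𝒳] {N K : ℕ}
    (P : Measure Ω) (X : Fin N → Ω → 𝒳) (Y : Fin N → Ω → Fin K) : Prop :=
  ∃ Q : Fin K → Measure 𝒳, ∀ y : Fin N → Fin K, P (labelEvent Y y) ≠ 0 →
    iIndepFun X (cond P (labelEvent Y y)) ∧
      ∀ i, (cond P (labelEvent Y y)).map (X i) = Q (y i)

end BatchConformal

end

namespace BatchConformal

/-! The Simes test rejects only if the Benjamini-Hochberg count R is positive, and then the shares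
1{m p_i ≤ αR}/R add up to at least 1 (`one_le_sum_rejShare`). So it suffices that each share has
mean at most α/m.

Fix i and pool its true-label score with its calibration scores. These are independent with equal
laws, so exchanging the batch score with any pool member preserves the joint law, and the mean share
equals its average over these exchanges. When T j is exchanged in, p_i becomes the rank of T j in
the pool divided by the pool size, and a larger T j lowers every p-value (`exceedCount_swap_anti`),
so R grows. A deterministic rank inequality (`sum_inv_le_of_rank`) then bounds the average
pointwise. -/

/-- The number of rejections of the Benjamini-Hochberg procedure at level `α`. -/
noncomputable def numRej {m : ℕ} (α : ℝ) (p : Fin m → ℝ) : ℕ :=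
  ((Finset.range (m + 1)).filter fun r : ℕ =>
    r ≤ (Finset.univ.filter fun i => (m : ℝ) * p i ≤ α * r).card).sup id

lemma numRej_le_card {m : ℕ} (α : ℝ) (p : Fin m → ℝ) :
    numRej α p ≤ (Finset.univ.filter fun i => (m : ℝ) * p i ≤ α * (numRej α p : ℕ)).card := by
  have hne : ((Finset.range (m + 1)).filter fun r : ℕ =>
      r ≤ (Finset.univ.filter fun i => (m : ℝ) * p i ≤ α * r).card).Nonempty :=
    ⟨0, by simp⟩
  obtain ⟨r, hr, hr'⟩ := Finset.exists_mem_eq_sup _ hne id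
  have : numRej α p = r := hr'
  rw [this]
  exact (Finset.mem_filter.1 hr).2

lemma le_numRej {m : ℕ} {α : ℝ} {p : Fin m → ℝ} {r : ℕ}
    (h : r ≤ (Finset.univ.filter fun i => (m : ℝ) * p i ≤ α * r).card) : r ≤ numRej α p := by
  refine Finset.le_sup (f := id) (Finset.mem_filter.2 ⟨?_, h⟩)
  have := h.trans (Finset.card_le_univ _)
  simp only [Fintype.card_fin] at this
  simpa [Nat.lt_succ_iff] using this

lemma numRej_anti {m : ℕ} (α : ℝ) : Antitone (numRej (m := m) α) := by
  intro p q hpq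
  refine le_numRej ((numRej_le_card α q).trans (Finset.card_le_card ?_))
  intro i hi
  simp only [Finset.mem_filter, Finset.mem_univ, true_and] at hi ⊢
  exact (mul_le_mul_of_nonneg_left (hpq i) (Nat.cast_nonneg m)).trans hi

/-- If the Simes minimum is attained at the zero-based index `l`, the `l + 1` smallest p-values all
lie below the threshold for r = `l + 1`. -/
lemma numRej_pos_of_simes_le {m : ℕ} (hm : 0 < m) {α : ℝ} {p : Fin m → ℝ} (h : simes p ≤ α) :
    0 < numRej α p := by
  have : Nonempty (Fin m) := ⟨⟨0, hm⟩⟩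
  obtain ⟨l, hl⟩ := exists_eq_ciInf_of_finite
    (f := fun l : Fin m => (m : ℝ) * orderStat p l / ((l : ℕ) + 1))
  have hl' : (m : ℝ) * orderStat p l / ((l : ℕ) + 1) ≤ α := hl.trans_le h
  rw [div_le_iff₀ (by positivity)] at hl'
  refine (Nat.succ_pos (l : ℕ)).trans_le (le_numRej ?_)
  rw [← Nat.add_one, ← Fin.card_Iic l, ← Finset.card_map (Tuple.sort p).toEmbedding]
  refine Finset.card_le_card fun i hi => ?_
  obtain ⟨k, hk, rfl⟩ := Finset.mem_map.1 hi
  simp only [Finset.mem_filter, Finset.mem_univ, true_and]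
  have hkl : p (Tuple.sort p k) ≤ p (Tuple.sort p l) :=
    Tuple.monotone_sort p (Finset.mem_Iic.1 hk)
  have := mul_le_mul_of_nonneg_left hkl (Nat.cast_nonneg (α := ℝ) m)
  rw [Finset.card_map, Fin.card_Iic]
  push_cast
  exact this.trans hl'

/-- The share of the `i`-th p-value in the rejections of the Benjamini-Hochberg procedure. -/
noncomputable def rejShare {m : ℕ} (α : ℝ) (p : Fin m → ℝ) (i : Fin m) : ℝ :=
  if (m : ℝ) * p i ≤ α * (numRej α p : ℕ) then ((numRej α p : ℕ) : ℝ)⁻¹ else 0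

lemma rejShare_nonneg {m : ℕ} (α : ℝ) (p : Fin m → ℝ) (i : Fin m) : 0 ≤ rejShare α p i := by
  unfold rejShare; split_ifs <;> positivity

lemma rejShare_le_one {m : ℕ} (α : ℝ) (p : Fin m → ℝ) (i : Fin m) : rejShare α p i ≤ 1 := by
  unfold rejShare; split_ifs
  · exact Nat.cast_inv_le_one _
  · exact zero_le_one

lemma one_le_sum_rejShare {m : ℕ} (hm : 0 < m) {α : ℝ} {p : Fin m → ℝ} (h : simes p ≤ α) :
    1 ≤ ∑ i, rejShare α p i := by
  have hR : (0 : ℝ) < (numRej α p : ℕ) := by exact_mod_cast numRej_pos_of_simes_le hm h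
  unfold rejShare
  rw [← Finset.sum_filter, Finset.sum_const, nsmul_eq_mul, ← div_eq_mul_inv, one_le_div hR]
  exact_mod_cast numRej_le_card α p

/-! ### Deterministic rank inequality -/

/-- Superuniform ranks with rejection counts that increase with the score. -/
lemma sum_inv_le_of_rank {ι : Type*} (B : Finset ι) (T : ι → ℝ) (R : ι → ℕ) {c : ℝ} (hc : 0 ≤ c)
    (hR : ∀ i ∈ B, ∀ j ∈ B, T i ≤ T j → R i ≤ R j) :
    ∑ j ∈ B, (if ((B.filter fun a => T j ≤ T a).card : ℝ) ≤ c * R j then (R j : ℝ)⁻¹ else 0)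
      ≤ c := by
  classical
  rw [← Finset.sum_filter]
  set H := B.filter fun j => ((B.filter fun a => T j ≤ T a).card : ℝ) ≤ c * R j
  rcases H.eq_empty_or_nonempty with h0 | hne
  · simpa [h0] using hc
  -- The lowest score `s` in `H` controls the sum: `H` lies in the upper set of `s`, so `H.card ≤ c
  -- * R s`, while monotonicity makes each term at most `1 / R s`.
  obtain ⟨s, hs, hmin⟩ := H.exists_min_image T hne
  obtain ⟨hsB, hsc⟩ := Finset.mem_filter.1 hs
  have hcard : (H.card : ℝ) ≤ c * R s := by
    refine le_trans ?_ hsc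
    exact_mod_cast Finset.card_le_card fun j hj =>
      Finset.mem_filter.2 ⟨(Finset.mem_filter.1 hj).1, hmin j hj⟩
  have hHpos : (0 : ℝ) < H.card := by exact_mod_cast hne.card_pos
  have hRs : (0 : ℝ) < R s := by
    by_contra h
    have : (R s : ℝ) = 0 := le_antisymm (not_lt.1 h) (Nat.cast_nonneg _)
    rw [this, mul_zero] at hcard
    linarith
  calc ∑ j ∈ H, (R j : ℝ)⁻¹ ≤ ∑ _j ∈ H, (R s : ℝ)⁻¹ := by
        refine Finset.sum_le_sum fun j hj => ?_
        refine inv_anti₀ hRs ?_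
        exact_mod_cast hR s hsB j (Finset.mem_filter.1 hj).1 (hmin j hj)
    _ = H.card / R s := by rw [Finset.sum_const, nsmul_eq_mul, div_eq_mul_inv]
    _ ≤ c := by rwa [div_le_iff₀ hRs]

/-! ### Exceedance counts under exchanges of scores -/

/-- The number of calibration scores that are at least as large as the `i`-th batch score. -/
noncomputable def exceedCount {ι : Type*} {m : ℕ} (e : Fin m → ι) (A : Fin m → Finset ι) (T : ι → ℝ)
    (i : Fin m) : ℕ :=
  ((A i).filter fun a => T (e i) ≤ T a).card

/-- The conformal p-value with exceedance counts `c` for calibration sets `A`. -/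
noncomputable def countPValue {ι : Type*} {m : ℕ} (A : Fin m → Finset ι) (c : Fin m → ℕ) (i : Fin m) : ℝ :=
  (1 + c i) / ((A i).card + 1)

section Swap

variable {ι : Type*} [DecidableEq ι] {m : ℕ} {e : Fin m → ι} {A : Fin m → Finset ι}

lemma sum_comp_swap {A : Finset ι} {k j : ι} (hk : k ∉ A) (hj : j ∈ insert k A) (f : ι → ℕ) :
    ∑ a ∈ A, f (Equiv.swap k j a) + f j = ∑ a ∈ insert k A, f a := by
  have h : ∑ a ∈ insert k A, f (Equiv.swap k j a) = ∑ a ∈ insert k A, f a := by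
    refine Finset.sum_equiv (Equiv.swap k j) (fun a => ?_) (fun _ _ => rfl)
    by_cases h1 : a = k
    · subst h1; simpa using hj
    by_cases h2 : a = j
    · subst h2; simpa using hj
    rw [Equiv.swap_apply_of_ne_of_ne h1 h2]
  rw [← h, Finset.sum_insert hk, Equiv.swap_apply_left, add_comm]

/-- The `+ 1` is `j` counting itself; it matches the 1 in the numerator of the p-value. -/
lemma exceedCount_swap_self (hA : ∀ i i', e i ∉ A i') (T : ι → ℝ) (i : Fin m) {j : ι}
    (hj : j ∈ insert (e i) (A i)) :
    exceedCount e A (T ∘ Equiv.swap (e i) j) i + 1 =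
      ((insert (e i) (A i)).filter fun a => T j ≤ T a).card := by
  have := sum_comp_swap (hA i i) hj (fun a => if T j ≤ T a then 1 else 0)
  simp only [le_refl, if_true] at this
  rw [exceedCount, Finset.card_filter, Finset.card_filter, ← this]
  simp

lemma exceedCount_swap_anti (he : Function.Injective e) (hA : ∀ i i', e i ∉ A i')
    (hAA : ∀ i i', A i = A i' ∨ Disjoint (A i) (A i')) (T : ι → ℝ) (i : Fin m) {j k : ι}
    (hj : j ∈ insert (e i) (A i)) (hk : k ∈ insert (e i) (A i)) (hjk : T j ≤ T k) :
    exceedCount e A (T ∘ Equiv.swap (e i) k) ≤ exceedCount e A (T ∘ Equiv.swap (e i) j) := by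
  intro l
  change exceedCount e A _ l ≤ exceedCount e A _ l
  by_cases hl : l = i
  · subst hl
    have h1 := exceedCount_swap_self hA T l hj
    have h2 := exceedCount_swap_self hA T l hk
    have h3 : ((insert (e l) (A l)).filter fun a => T k ≤ T a).card ≤
        ((insert (e l) (A l)).filter fun a => T j ≤ T a).card :=
      Finset.card_le_card fun a ha => by
        rw [Finset.mem_filter] at ha ⊢
        exact ⟨ha.1, hjk.trans ha.2⟩
    omega
  have hfix : ∀ s ∈ insert (e i) (A i), Equiv.swap (e i) s (e l) = e l := by
    intro s hs
    refine Equiv.swap_apply_of_ne_of_ne (fun h => hl (he h)) ?_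
    rintro rfl
    rcases Finset.mem_insert.1 hs with h | h
    · exact hl (he h)
    · exact hA _ _ h
  simp only [exceedCount, Function.comp, hfix j hj, hfix k hk]
  -- With the same calibration set, the threshold `T (e l)` is fixed and removing the larger score
  -- `T k` from the pool leaves fewer exceedances. With disjoint sets the count does not change.
  rcases hAA i l with hil | hil
  · have h1 := sum_comp_swap (hA i i) hj (fun a => if T (e l) ≤ T a then 1 else 0)
    have h2 := sum_comp_swap (hA i i) hk (fun a => if T (e l) ≤ T a then 1 else 0)
    have h3 : (if T (e l) ≤ T j then 1 else 0) ≤ if T (e l) ≤ T k then 1 else 0 := by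
      split_ifs with ha hb
      · exact le_rfl
      · exact absurd (ha.trans hjk) hb
      · exact zero_le_one
      · exact le_rfl
    rw [← hil, Finset.card_filter, Finset.card_filter]
    omega
  · have hout : ∀ s ∈ insert (e i) (A i), ∀ a ∈ A l, Equiv.swap (e i) s a = a := by
      intro s hs a ha
      refine Equiv.swap_apply_of_ne_of_ne (fun h => hA i l (h ▸ ha)) ?_
      rintro rfl
      rcases Finset.mem_insert.1 hs with h | h
      · exact hA i l (h ▸ ha)
      · exact Finset.disjoint_left.1 hil h ha
    refine (congrArg Finset.card (Finset.filter_congr fun a ha => ?_)).le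
    rw [hout j hj a ha, hout k hk a ha]

/-- Averaged over the exchanges of the `i`-th batch score with its calibration scores, the share of
the `i`-th p-value is at most `α / m`. -/
lemma sum_rejShare_swap_le (hm : 0 < m) (he : Function.Injective e) (hA : ∀ i i', e i ∉ A i')
    (hAA : ∀ i i', A i = A i' ∨ Disjoint (A i) (A i')) {α : ℝ} (hα : 0 ≤ α) (T : ι → ℝ)
    (i : Fin m) :
    ∑ j ∈ insert (e i) (A i),
        rejShare α (countPValue A (exceedCount e A (T ∘ Equiv.swap (e i) j))) i ≤
      ((A i).card + 1) * (α / m) := by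
  have hm' : (0 : ℝ) < m := by exact_mod_cast hm
  refine le_trans (Finset.sum_congr rfl fun j hj => ?_).le
    (sum_inv_le_of_rank (insert (e i) (A i)) T
      (fun j => numRej α (countPValue A (exceedCount e A (T ∘ Equiv.swap (e i) j))))
      (by positivity) fun j hj k hk hjk => numRej_anti α fun l => ?_)
  -- Since p_i is the rank over `(A i).card + 1`, the condition m p_i ≤ αR reads rank ≤ c R with c =
  -- `((A i).card + 1) * (α / m)`.
  · have h := exceedCount_swap_self hA T i hj
    rw [rejShare]
    refine if_congr ?_ rfl rfl
    rw [← h]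
    generalize numRej α _ = R
    rw [countPValue, ← mul_div_assoc, div_le_iff₀ (by positivity)]
    push_cast
    rw [show ((A i).card + 1 : ℝ) * (α / m) * R = (α * R * ((A i).card + 1)) / m by ring,
      le_div_iff₀ hm', mul_comm (m : ℝ), add_comm (1 : ℝ)]
  · have := exceedCount_swap_anti he hA hAA T i hj hk hjk l
    unfold countPValue
    gcongr

end Swap

/-! ### Averaging over exchanges and the Simes inequality -/

/-- Independent variables may be exchanged without changing their joint law if the exchange keeps
the marginal laws. -/
lemma map_comp_perm_eq {Ω ι : Type*} [MeasurableSpace Ω] [Fintype ι] {μ : Measure Ω}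
    [IsProbabilityMeasure μ] {T : ι → Ω → ℝ} (hT : ∀ i, Measurable (T i)) (hind : iIndepFun T μ)
    (σ : Equiv.Perm ι) (hσ : ∀ i, μ.map (T (σ i)) = μ.map (T i)) :
    μ.map (fun ω i => T (σ i) ω) = μ.map (fun ω i => T i ω) := by
  rw [(iIndepFun_iff_map_fun_eq_pi_map fun i => (hT i).aemeasurable).1 hind,
    (iIndepFun_iff_map_fun_eq_pi_map fun i => (hT (σ i)).aemeasurable).1
      (hind.precomp σ.injective)]
  simp_rw [hσ]

lemma measurable_exceedCount {ι : Type*} {m : ℕ} (e : Fin m → ι) (A : Fin m → Finset ι) :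
    Measurable (exceedCount e A) := by
  refine measurable_pi_lambda _ fun i => ?_
  simp only [exceedCount, Finset.card_filter]
  refine Finset.measurable_sum _ fun a _ => ?_
  exact Measurable.ite (measurableSet_le (measurable_pi_apply _) (measurable_pi_apply _))
    measurable_const measurable_const

lemma integral_rejShare_le {Ω ι : Type*} [MeasurableSpace Ω] [Fintype ι]
    {m : ℕ} (hm : 0 < m) {e : Fin m → ι} {A : Fin m → Finset ι}
    (he : Function.Injective e) (hA : ∀ i i', e i ∉ A i')
    (hAA : ∀ i i', A i = A i' ∨ Disjoint (A i) (A i')) {α : ℝ} (hα : 0 ≤ α)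
    {μ : Measure Ω} [IsProbabilityMeasure μ] {T : ι → Ω → ℝ} (hT : ∀ i, Measurable (T i))
    (hind : iIndepFun T μ) (hlaw : ∀ i, ∀ j ∈ A i, μ.map (T j) = μ.map (T (e i))) (i : Fin m) :
    ∫ ω, rejShare α (countPValue A (exceedCount e A fun a => T a ω)) i ∂μ ≤ α / m := by
  classical
  set F : (ι → ℝ) → ℝ := fun t => rejShare α (countPValue A (exceedCount e A t)) i
  -- `F` factors through the integer counts, a discrete space on which every function is measurable.
  have hFm : Measurable F :=
    (Measurable.of_discrete (f := fun c : Fin m → ℕ => rejShare α (countPValue A c) i)).comp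
      (measurable_exceedCount e A)
  have hTm : ∀ σ : Equiv.Perm ι, Measurable fun ω a => T (σ a) ω :=
    fun σ => measurable_pi_lambda _ fun a => hT _
  have hswap : ∀ j ∈ insert (e i) (A i),
      ∫ ω, F ((fun a => T a ω) ∘ Equiv.swap (e i) j) ∂μ = ∫ ω, F (fun a => T a ω) ∂μ := by
    intro j hj
    have hj' : μ.map (T j) = μ.map (T (e i)) := by
      rcases Finset.mem_insert.1 hj with rfl | h
      · rfl
      · exact hlaw i j h
    have hmap := map_comp_perm_eq hT hind (Equiv.swap (e i) j) fun a => by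
      by_cases h1 : a = e i
      · rw [h1, Equiv.swap_apply_left, hj']
      by_cases h2 : a = j
      · rw [h2, Equiv.swap_apply_right, hj']
      rw [Equiv.swap_apply_of_ne_of_ne h1 h2]
    have h1 := integral_map (μ := μ) (hTm (Equiv.swap (e i) j)).aemeasurable
      hFm.aestronglyMeasurable
    have h2 := integral_map (μ := μ) (hTm 1).aemeasurable hFm.aestronglyMeasurable
    rw [hmap] at h1
    exact h1.symm.trans h2
  have hint : ∀ j ∈ insert (e i) (A i),
      Integrable (fun ω => F ((fun a => T a ω) ∘ Equiv.swap (e i) j)) μ := fun j _ =>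
    Integrable.of_bound (hFm.comp (hTm (Equiv.swap (e i) j))).aestronglyMeasurable 1
      (ae_of_all _ fun ω => by
        rw [Real.norm_of_nonneg (rejShare_nonneg _ _ _)]
        exact rejShare_le_one _ _ _)
  have hle : ∫ ω, ∑ j ∈ insert (e i) (A i), F ((fun a => T a ω) ∘ Equiv.swap (e i) j) ∂μ ≤
      ∫ _ω, ((A i).card + 1) * (α / m) ∂μ :=
    integral_mono (integrable_finsetSum _ hint) (integrable_const _) fun ω =>
      sum_rejShare_swap_le hm he hA hAA hα (fun a => T a ω) i
  rw [integral_finsetSum _ hint, Finset.sum_congr rfl hswap, Finset.sum_const,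
    Finset.card_insert_of_notMem (hA i i), nsmul_eq_mul, integral_const, probReal_univ,
    one_smul] at hle
  push_cast at hle
  exact le_of_mul_le_mul_left hle (by positivity)

/-- The Simes inequality for conformal p-values of independent scores: the calibration sets of two
batch members are equal or disjoint, and calibration scores have the law of the batch score. -/
theorem one_sub_le_measureReal_simes {Ω ι : Type*} [MeasurableSpace Ω] [Fintype ι]
    {m : ℕ} (hm : 0 < m) {e : Fin m → ι} {A : Fin m → Finset ι}
    (he : Function.Injective e) (hA : ∀ i i', e i ∉ A i')
    (hAA : ∀ i i', A i = A i' ∨ Disjoint (A i) (A i')) {α : ℝ} (hα : 0 ≤ α)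
    {μ : Measure Ω} [IsProbabilityMeasure μ] {T : ι → Ω → ℝ} (hT : ∀ i, Measurable (T i))
    (hind : iIndepFun T μ) (hlaw : ∀ i, ∀ j ∈ A i, μ.map (T j) = μ.map (T (e i))) :
    1 - α ≤ μ.real {ω | α < simes (countPValue A (exceedCount e A fun a => T a ω))} := by
  have hc : Measurable fun ω => exceedCount e A fun a => T a ω :=
    (measurable_exceedCount e A).comp (measurable_pi_lambda _ hT)
  have hmeas : MeasurableSet {ω | α < simes (countPValue A (exceedCount e A fun a => T a ω))} :=
    hc (MeasurableSet.of_discrete (s := {c : Fin m → ℕ | α < simes (countPValue A c)}))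
  have hint : ∀ i ∈ Finset.univ, Integrable
      (fun ω => rejShare α (countPValue A (exceedCount e A fun a => T a ω)) i) μ := fun i _ =>
    Integrable.of_bound ((Measurable.of_discrete
      (f := fun c : Fin m → ℕ => rejShare α (countPValue A c) i)).comp hc).aestronglyMeasurable 1
      (ae_of_all _ fun ω => by
        rw [Real.norm_of_nonneg (rejShare_nonneg _ _ _)]
        exact rejShare_le_one _ _ _)
  set E := {ω | α < simes (countPValue A (exceedCount e A fun a => T a ω))}
  have h1 : μ.real Eᶜ ≤ α := by
    calc μ.real Eᶜ = ∫ ω, Eᶜ.indicator (fun _ => (1 : ℝ)) ω ∂μ := by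
          rw [integral_indicator_const _ hmeas.compl, smul_eq_mul, mul_one]
      _ ≤ ∫ ω, ∑ i, rejShare α (countPValue A (exceedCount e A fun a => T a ω)) i ∂μ := by
          refine integral_mono ((integrable_const _).indicator hmeas.compl)
            (integrable_finsetSum _ hint) fun ω => ?_
          by_cases hω : ω ∈ Eᶜ
          · simp only [Set.indicator_of_mem hω]
            exact one_le_sum_rejShare hm (not_lt.1 hω)
          · simp only [Set.indicator_of_notMem hω]
            exact Finset.sum_nonneg fun i _ => rejShare_nonneg _ _ _
      _ = ∑ i, ∫ ω, rejShare α (countPValue A (exceedCount e A fun a => T a ω)) i ∂μ :=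
          integral_finsetSum _ hint
      _ ≤ ∑ _i : Fin m, α / m :=
          Finset.sum_le_sum fun i _ => integral_rejShare_le hm he hA hAA hα hT hind hlaw i
      _ = α := by
          have : (m : ℝ) ≠ 0 := by exact_mod_cast hm.ne'
          rw [Finset.sum_const, Finset.card_univ, Fintype.card_fin, nsmul_eq_mul]
          field_simp
  rw [probReal_compl_eq_one_sub hmeas] at h1
  linarith

/-! ### Application to the two models -/

/-- The conformal p-values of the true labels in terms of exceedance counts. -/
lemma pValue_eq_countPValue {𝒳 : Type*} {n m K : ℕ} (S : Fin K → 𝒳 → ℝ)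
    (D : Fin K → Finset (Fin n)) (x : Fin (n + m) → 𝒳) (y : Fin (n + m) → Fin K) :
    (fun i : Fin m => pValue S D (fun j => x (Fin.castAdd m j)) (fun j => y (Fin.castAdd m j))
        (fun i => x (Fin.natAdd n i)) (y (Fin.natAdd n i)) i) =
      countPValue (fun i => (D (y (Fin.natAdd n i))).map (Fin.castAddEmb m))
        (exceedCount (Fin.natAdd n) (fun i => (D (y (Fin.natAdd n i))).map (Fin.castAddEmb m))
          fun a => S (y a) (x a)) := by
  funext i
  simp only [pValue, countPValue, exceedCount, Finset.card_filter, Finset.sum_map,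
    Finset.card_map, Fin.castAddEmb_apply, Nat.cast_sum]
  congr 2
  refine Finset.sum_congr rfl fun j _ => ?_
  split_ifs with h
  · exact (Nat.cast_one.symm.trans (congrArg _ (if_pos h).symm))
  · exact (Nat.cast_zero.symm.trans (congrArg _ (if_neg h).symm))

lemma natAdd_notMem_map_castAddEmb {n m : ℕ} (i : Fin m) (D : Finset (Fin n)) :
    Fin.natAdd n i ∉ D.map (Fin.castAddEmb m) := by
  intro h
  obtain ⟨j, -, hj⟩ := Finset.mem_map.1 h
  have := congrArg Fin.val hj
  simp at this
  omega

theorem one_sub_le_fullSimesSet {Ω 𝒳 : Type*} [MeasurableSpace Ω] [MeasurableSpace 𝒳]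
    {n m K : ℕ} (hm : 0 < m) {P : Measure Ω} [IsProbabilityMeasure P]
    {S : Fin K → 𝒳 → ℝ} (hS : ∀ k, Measurable (S k))
    {X : Fin (n + m) → Ω → 𝒳} (hX : ∀ i, Measurable (X i))
    {Y : Fin (n + m) → Ω → Fin K} (hY : ∀ i, Measurable (Y i))
    {α : ℝ} (hα : 0 ≤ α) (hiid : IIDModel P X Y) :
    1 - α ≤ P.real {ω | (fun i : Fin m => Y (Fin.natAdd n i) ω) ∈
      fullSimesSet S (fun j : Fin n => X (Fin.castAdd m j) ω)
        (fun j : Fin n => Y (Fin.castAdd m j) ω) (fun i : Fin m => X (Fin.natAdd n i) ω) α} := by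
  have hg : Measurable fun q : 𝒳 × Fin K => S q.2 q.1 := measurable_from_prod_countable_left hS
  have key := one_sub_le_measureReal_simes hm (e := Fin.natAdd n)
    (A := fun _ => (Finset.univ : Finset (Fin n)).map (Fin.castAddEmb m))
    (Fin.natAdd_injective m n) (fun i _ => natAdd_notMem_map_castAddEmb i _)
    (fun _ _ => Or.inl rfl) hα (μ := P) (T := fun a ω => S (Y a ω) (X a ω))
    (fun a => hg.comp ((hX a).prodMk (hY a)))
    (hiid.1.comp (fun _ q => S q.2 q.1) fun _ => hg)
    (fun i j _ => ((hiid.2 j (Fin.natAdd n i)).comp hg).map_eq)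
  convert key using 4 with ω
  simp only [fullSimesSet, simesSet, Set.mem_ofPred_eq]
  rw [pValue_eq_countPValue S (fullCal n K) (fun a => X a ω) fun a => Y a ω]
  rfl

theorem one_sub_le_classSimesSet {Ω 𝒳 : Type*} [MeasurableSpace Ω] [MeasurableSpace 𝒳]
    {n m K : ℕ} (hm : 0 < m) {P : Measure Ω} [IsProbabilityMeasure P]
    {S : Fin K → 𝒳 → ℝ} (hS : ∀ k, Measurable (S k))
    {X : Fin (n + m) → Ω → 𝒳} (hX : ∀ i, Measurable (X i))
    {Y : Fin (n + m) → Ω → Fin K} (hY : ∀ i, Measurable (Y i))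
    {α : ℝ} (hα : 0 ≤ α) (hcc : ClassConditionalModel P X Y)
    (y : Fin (n + m) → Fin K) (hy : P (labelEvent Y y) ≠ 0) :
    1 - α ≤ (cond P (labelEvent Y y)).real {ω | (fun i : Fin m => Y (Fin.natAdd n i) ω) ∈
      classSimesSet S (fun j : Fin n => X (Fin.castAdd m j) ω)
        (fun j : Fin n => Y (Fin.castAdd m j) ω) (fun i : Fin m => X (Fin.natAdd n i) ω) α} := by
  obtain ⟨Q, hQ⟩ := hcc
  obtain ⟨hind, hlaw⟩ := hQ y hy
  have := cond_isProbabilityMeasure hy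
  have hmeas : MeasurableSet (labelEvent Y y) := by
    have : labelEvent Y y = ⋂ i, Y i ⁻¹' {y i} := by ext; simp [labelEvent]
    rw [this]
    exact MeasurableSet.iInter fun i => hY i (measurableSet_singleton _)
  have hST : ∀ j, (cond P (labelEvent Y y)).map (fun ω => S (y j) (X j ω)) =
      (Q (y j)).map (S (y j)) := fun j => by
    rw [← hlaw j, Measure.map_map (hS _) (hX _)]; rfl
  have key := one_sub_le_measureReal_simes hm (e := Fin.natAdd n)
    (A := fun i => (classCal (fun j => y (Fin.castAdd m j)) (y (Fin.natAdd n i))).map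
      (Fin.castAddEmb m))
    (Fin.natAdd_injective m n) (fun i _ => natAdd_notMem_map_castAddEmb i _)
    -- Batch members with the same label share a calibration set; different labels give disjoint
    -- ones.
    (fun i i' => by
      by_cases h : y (Fin.natAdd n i) = y (Fin.natAdd n i')
      · exact Or.inl (by rw [h])
      · refine Or.inr ((Finset.disjoint_map _).2 (Finset.disjoint_left.2 fun j hj hj' => h ?_))
        simp only [classCal, Finset.mem_filter, Finset.mem_univ, true_and] at hj hj'
        exact hj.symm.trans hj')
    -- Freezing the labels at `y` makes each score a function of its own covariate, so independence
    -- carries over; the random labels are put back almost surely at the end.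
    hα (μ := cond P (labelEvent Y y)) (T := fun a ω => S (y a) (X a ω))
    (fun a => (hS _).comp (hX a)) (hind.comp (fun a => S (y a)) fun a => hS _)
    (fun i j hj => by
      obtain ⟨k, hk, rfl⟩ := Finset.mem_map.1 hj
      simp only [classCal, Finset.mem_filter, Finset.mem_univ, true_and] at hk
      have hk' : y (Fin.castAddEmb m k) = y (Fin.natAdd n i) := hk
      rw [hST, hST, hk'])
  refine key.trans_eq (measureReal_congr ?_)
  refine Filter.eventuallyEq_set.2 ?_
  filter_upwards [ae_cond_mem hmeas] with ω hω
  have hYy : ∀ a, Y a ω = y a := hω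
  simp only [classSimesSet, simesSet, Set.mem_ofPred_eq, hYy]
  rw [pValue_eq_countPValue S (classCal fun j => y (Fin.castAdd m j)) (fun a => X a ω) y]

end BatchConformal

theorem theorem1 {Ω 𝒳 : Type*} [MeasurableSpace Ω] [MeasurableSpace 𝒳] {n m K : ℕ} (hm : 0 < m)
    (P : Measure Ω) [IsProbabilityMeasure P]
    (S : Fin K → 𝒳 → ℝ) (hS : ∀ k, Measurable (S k))
    (X : Fin (n + m) → Ω → 𝒳) (hX : ∀ i, Measurable (X i))
    (Y : Fin (n + m) → Ω → Fin K) (hY : ∀ i, Measurable (Y i))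
    (hties : ∀ᵐ ω ∂P, Function.Injective fun i => S (Y i ω) (X i ω))
    (α : ℝ) (hα : 0 ≤ α) :
    (BatchConformal.IIDModel P X Y →
      1 - α ≤ P.real {ω | (fun i : Fin m => Y (Fin.natAdd n i) ω) ∈
        BatchConformal.fullSimesSet S (fun j : Fin n => X (Fin.castAdd m j) ω)
          (fun j : Fin n => Y (Fin.castAdd m j) ω)
          (fun i : Fin m => X (Fin.natAdd n i) ω) α}) ∧
    (BatchConformal.ClassConditionalModel P X Y →
      ∀ y : Fin (n + m) → Fin K, P (BatchConformal.labelEvent Y y) ≠ 0 →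
        1 - α ≤ (cond P (BatchConformal.labelEvent Y y)).real
          {ω | (fun i : Fin m => Y (Fin.natAdd n i) ω) ∈
            BatchConformal.classSimesSet S (fun j : Fin n => X (Fin.castAdd m j) ω)
              (fun j : Fin n => Y (Fin.castAdd m j) ω)
              (fun i : Fin m => X (Fin.natAdd n i) ω) α}) := by
  exact ⟨BatchConformal.one_sub_le_fullSimesSet hm hS hX hY hα,
    BatchConformal.one_sub_le_classSimesSet hm hS hX hY hα⟩
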